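/- Let $\Bbbk$ be an algebraically closed field of characteristic zero and let $\mathcal C$ be a pivotal finite tensor category over $\Bbbk$, i.e. a rigid monoidal, finite $\Bbbk$-linear abelian category with $\Bbbk$-bilinear tensor product and $\operatorname{End}(\mathbf 1)\cong\Bbbk$ as algebras, together with a monoidal natural isomorphism $j:\mathrm{id}_{\mathcal C}\to(-)^{**}$. Let $F:\mathcal Z(\mathcal C)\to\mathcal C$ be the forgetful functor from the Drinfeld center, $R$ a right adjoint of $F$ with counit $\epsilon$, $A=R(\mathbf 1)$ the adjoint algebra (an algebra in $\mathcal Z(\mathcal C)$ through the lax monoidal structure of $R$), and $\epsilon_{\mathbf 1}:A\to\mathbf 1$ the value of the counit at $\mathbf 1$. For an object $M$ let $\pi_M:A\to M\otimes M^*$ be the canonical dinatural morphism, i.e. the composite of $\mathrm{id}_A\otimes\mathrm{coev}_M$ with $\big((\mathrm{id}_M\otimes\epsilon_{\mathbf 1})\circ c_{A,M}\big)\otimes\mathrm{id}_{M^*}$, where $c_{A,-}$ is the half braiding of $A$; let $$\alpha_M=(\mathrm{id}_M\otimes \mathrm{ev}_M)\circ(\pi_M\otimes \mathrm{id}_M):A\otimes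 M\to M$$ be the canonical action, let $$\widetilde{\mathrm{ev}}_M=\mathrm{ev}_{M^*}\circ(j_M\otimes\mathrm{id}_{M^*}),\qquad \mathrm{ch}(M)=\widetilde{\mathrm{ev}}_M\circ(\alpha_M\otimes\mathrm{id}_{M^*})\circ(\mathrm{id}_A\otimes\mathrm{coev}_M):A\to\mathbf 1$$ be the right evaluation and the internal character, and let $d(M)\in\Bbbk$ be the right pivotal dimension, $d(M)\,\mathrm{id}_{\mathbf 1}=\widetilde{\mathrm{ev}}_M\circ\mathrm{coev}_M$. Let $\iota: L\hookrightarrow A$ be a unitary subalgebra in $\mathcal Z(\mathcal C)$ (a monomorphism of unital algebras), and put $\underline\epsilon_L=\epsilon_{\mathbf 1}\circ\iota:L\to\mathbf 1$ and $\mathrm{Res}(f)=f\circ\iota$ for $f:A\to\mathbf 1$. Let $\mathcal C_L^{\mathrm{triv}}$ be the full abelian subcategory of $\mathcal C$ of all objects $M$ on which $L$ acts trivially, i.e. $\alpha_M\circ(\iota\otimes\mathrm{id}_M)=\underline\epsilon_L\otimes\mathrm{id}_M$. Let $\mathcal S_L$ be the full abelian subcategory of $\mathcal C$ generated by the simple objects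 $V$ with $\mathrm{Res}(\mathrm{ch}(V))=d(V)\,\underline\epsilon_L$, i.e. consisting of the objects all of whose composition factors are such $V$. Then $$\mathcal C_L^{\mathrm{triv}}\subseteq\mathcal S_L ,$$ and moreover $\mathrm{Res}(\mathrm{ch}(M))=d(M)\,\underline\epsilon_L$ for every object $M$ of $\mathcal C_L^{\mathrm{triv}}$. -/

import Mathlib

open CategoryTheory MonoidalCategory Limits
open scoped MonObj ZeroObject

universe v u w

noncomputable section

namespace FTC

section Pivotal

variable {C : Type u} [Category.{v} C] [MonoidalCategory C] [RightRigidCategory C]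

/-- The dual object `X*`, with its evaluation `X* ⊗ X ⟶ 𝟙` and coevaluation `𝟙 ⟶ X ⊗ X*`. -/
abbrev dual (X : C) : C := @HasRightDual.rightDual C _ _ X (RightRigidCategory.rightDual X)

/-- `ev_X : X* ⊗ X ⟶ 𝟙`. -/
abbrev ev (X : C) : dual X ⊗ X ⟶ 𝟙_ C := ExactPairing.evaluation X (dual X)

/-- `coev_X : 𝟙 ⟶ X ⊗ X*`. -/
abbrev coev (X : C) : 𝟙_ C ⟶ X ⊗ dual X := ExactPairing.coevaluation X (dual X)

/-- The transpose `f* : Y* ⟶ X*` of `f : X ⟶ Y`. -/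
abbrev dualMap {X Y : C} (f : X ⟶ Y) : dual Y ⟶ dual X :=
  @rightAdjointMate C _ _ X Y (RightRigidCategory.rightDual X) (RightRigidCategory.rightDual Y) f

/-- The canonical isomorphism `(X ⊗ Y)* ≅ Y* ⊗ X*` (uniqueness of duals). -/
def dualTensor (X Y : C) : dual (X ⊗ Y) ≅ dual Y ⊗ dual X :=
  rightDualIso (X := X ⊗ Y) inferInstance ExactPairing.tensor

/-- The canonical isomorphism `𝟙* ≅ 𝟙` (uniqueness of duals). -/
def dualUnit : dual (𝟙_ C) ≅ 𝟙_ C :=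
  rightDualIso (X := 𝟙_ C) (@HasRightDual.exact C _ _ _ (RightRigidCategory.rightDual (𝟙_ C)))
    exactPairingUnit

/-- The monoidal structure morphism `X** ⊗ Y** ⟶ (X ⊗ Y)**` of the functor `(-)**`. -/
def bidualTensor (X Y : C) : dual (dual X) ⊗ dual (dual Y) ⟶ dual (dual (X ⊗ Y)) :=
  (dualTensor (dual Y) (dual X)).inv ≫ dualMap (dualTensor X Y).hom

/-- The monoidal structure morphism `𝟙 ⟶ 𝟙**` of the functor `(-)**`. -/
def bidualUnit : 𝟙_ C ⟶ dual (dual (𝟙_ C)) :=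
  dualUnit.inv ≫ dualMap (dualUnit (C := C)).hom

variable (C) in
/-- A pivotal structure: a monoidal natural isomorphism `j : id ≅ (-)**`. -/
structure PivotalStructure where
  j (X : C) : X ≅ dual (dual X)
  naturality {X Y : C} (f : X ⟶ Y) : f ≫ (j Y).hom = (j X).hom ≫ dualMap (dualMap f)
  unit : (j (𝟙_ C)).hom = bidualUnit
  tensor (X Y : C) :
    (j (X ⊗ Y)).hom = ((j X).hom ⊗ₘ (j Y).hom) ≫ bidualTensor X Y

/-- The right evaluation `X ⊗ X* ⟶ X** ⊗ X* ⟶ 𝟙` of a pivotal structure. -/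
def PivotalStructure.rev (p : PivotalStructure C) (X : C) : X ⊗ dual X ⟶ 𝟙_ C :=
  (p.j X).hom ▷ dual X ≫ ev (dual X)

/-- The right partial pivotal trace `A ⟶ B` of `f : A ⊗ X ⟶ B ⊗ X`. -/
def PivotalStructure.partialTrace (p : PivotalStructure C) {A B : C} (X : C)
    (f : A ⊗ X ⟶ B ⊗ X) : A ⟶ B :=
  (ρ_ A).inv ≫ A ◁ coev X ≫ (α_ A X (dual X)).inv ≫ f ▷ dual X ≫
    (α_ B X (dual X)).hom ≫ B ◁ p.rev X ≫ (ρ_ B).hom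

/-- The right pivotal trace of an endomorphism, as an endomorphism of the unit object. -/
def PivotalStructure.trace (p : PivotalStructure C) {X : C} (f : X ⟶ X) : End (𝟙_ C) :=
  p.partialTrace X (𝟙_ C ◁ f)

end Pivotal

/-- A finite tensor category over `k`: a rigid monoidal, `k`-linear abelian category with
`k`-bilinear tensor product which is finite (finite-dimensional morphism spaces, all objects of
finite length, enough projectives, finitely many simple objects up to isomorphism), and with
`End 𝟙 ≃ k` as `k`-algebras. -/
class IsFiniteTensorCategory (k : Type w) [Field k] (C : Type u) [Category.{v} C] [Abelian C]
    [Linear k C] [MonoidalCategory C] [MonoidalPreadditive C] [MonoidalLinear k C]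
    [RigidCategory C] : Prop where
  finite_hom (X Y : C) : Module.Finite k (X ⟶ Y)
  noetherian (X : C) : IsNoetherianObject X
  artinian (X : C) : IsArtinianObject X
  enoughProjectives : EnoughProjectives C
  finite_simples : ∃ (n : ℕ) (S : Fin n → C), ∀ X : C, Simple X → ∃ i, Nonempty (X ≅ S i)
  end_unit : Nonempty (End (𝟙_ C) ≃ₐ[k] k)

section Dimension

variable (k : Type w) [Field k] {C : Type u} [Category.{v} C] [Abelian C]
    [Linear k C] [MonoidalCategory C] [MonoidalPreadditive C] [MonoidalLinear k C]
    [RigidCategory C] [IsFiniteTensorCategory k C]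

/-- The right pivotal dimension `d(X)`: the scalar corresponding to the trace of `id_X` under the
(unique) isomorphism of `k`-algebras `End 𝟙 ≃ k`. -/
def PivotalStructure.dim (p : PivotalStructure C) (X : C) : k :=
  (IsFiniteTensorCategory.end_unit (k := k) (C := C)).some (p.trace (𝟙 X))

theorem PivotalStructure.dim_smul_id (p : PivotalStructure C) (X : C) :
    p.dim k X • 𝟙 (𝟙_ C) = p.trace (𝟙 X) := by
  set e := (IsFiniteTensorCategory.end_unit (k := k) (C := C)).some with he
  apply e.injective
  have : p.dim k X • 𝟙 (𝟙_ C) = algebraMap k (End (𝟙_ C)) (p.dim k X) := by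
    rw [Algebra.algebraMap_eq_smul_one]; rfl
  rw [this, AlgEquiv.commutes]
  rfl

end Dimension

section AdjointAlgebra

variable {C : Type u} [Category.{v} C] [MonoidalCategory C]
  {R : C ⥤ Center C} (adj : Center.forget C ⊣ R)

/-- The adjoint algebra `A = R(𝟙)` in the Drinfeld center, where `R` is a right adjoint of the
forgetful functor `F : Z(C) ⥤ C`. -/
def adjointAlgebra (_ : Center.forget C ⊣ R) : Center C := R.obj (𝟙_ C)

/-- The algebra structure on `A = R(𝟙)` in `Z(C)`, induced by the algebra `𝟙` and the
lax monoidal structure of `R` as the right adjoint of a monoidal functor. -/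
instance : MonObj (adjointAlgebra adj) :=
  letI := adj.rightAdjointLaxMonoidal
  R.monObjObj (X := 𝟙_ C)

/-- The counit `ε_𝟙 : A ⟶ 𝟙` of the adjunction, a morphism in `C`. -/
def counit : (adjointAlgebra adj).1 ⟶ 𝟙_ C := adj.counit.app (𝟙_ C)

/-- A unitary subalgebra of `A` in `Z(C)`: a monomorphism `incl : L ⟶ A` in `Z(C)` of
unital algebras. -/
structure UnitarySubalgebra where
  L : Center C
  [mon : MonObj L]
  incl : L ⟶ adjointAlgebra adj
  [mono : Mono incl]
  [isMonHom : IsMonHom incl]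

variable [RigidCategory C]

/-- The universal dinatural transformation `π_{𝟙;X} : A ⟶ X ⊗ X*` that exhibits `A` as the end of
`X ⊗ X*`, written through the half braiding and the counit of `A`:
`A ⟶ A ⊗ X ⊗ X* ⟶ X ⊗ A ⊗ X* ⟶ X ⊗ X*`. -/
def proj (X : C) : (adjointAlgebra adj).1 ⟶ X ⊗ dual X :=
  (ρ_ _).inv ≫ (adjointAlgebra adj).1 ◁ coev X ≫ (α_ _ _ _).inv ≫
    (((adjointAlgebra adj).2.β X).hom ≫ X ◁ counit adj ≫ (ρ_ X).hom) ▷ dual X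

/-- The canonical action `α_X : A ⊗ X ⟶ X ⊗ X* ⊗ X ⟶ X` of the adjoint algebra. -/
def action (X : C) : (adjointAlgebra adj).1 ⊗ X ⟶ X :=
  proj adj X ▷ X ≫ (α_ X (dual X) X).hom ≫ X ◁ ev X ≫ (ρ_ X).hom

/-- The internal character `ch(X) : A ⟶ 𝟙`, the partial pivotal trace of the action `α_X`. -/
def character (p : PivotalStructure C) (X : C) : (adjointAlgebra adj).1 ⟶ 𝟙_ C :=
  p.partialTrace X (action adj X ≫ (λ_ X).inv)

/-- The action can be written as `A ⊗ X ⟶ X ⊗ A ⟶ X` with the half braiding and the counit. -/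
theorem action_eq (X : C) :
    action adj X =
      ((adjointAlgebra adj).2.β X).hom ≫ X ◁ counit adj ≫ (ρ_ X).hom := by
  unfold action proj
  generalize ((adjointAlgebra adj).2.β X).hom ≫ X ◁ counit adj ≫ (ρ_ X).hom = g
  generalize (adjointAlgebra adj).1 = A at g
  calc
    _ = 𝟙 _ ⊗≫ A ◁ coev X ▷ X ⊗≫ (g ▷ (dual X ⊗ X) ≫ X ◁ ev X) ⊗≫ 𝟙 _ := by monoidal
    _ = 𝟙 _ ⊗≫ A ◁ coev X ▷ X ⊗≫ ((A ⊗ X) ◁ ev X ≫ g ▷ 𝟙_ C) ⊗≫ 𝟙 _ := by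
      rw [whisker_exchange]
    _ = 𝟙 _ ⊗≫ A ◁ (coev X ▷ X ⊗≫ X ◁ ev X) ⊗≫ g := by monoidal
    _ = g := by rw [ExactPairing.evaluation_coevaluation'']; monoidal

/-- The action is natural in the object. -/
theorem action_naturality {X Y : C} (f : X ⟶ Y) :
    action adj X ≫ f = (adjointAlgebra adj).1 ◁ f ≫ action adj Y := by
  simp only [action_eq, Category.assoc, HalfBraiding.naturality_assoc]
  rw [← whisker_exchange_assoc]
  simp

end AdjointAlgebra

section Subcategories

variable {C : Type u} [Category.{v} C] [Abelian C] [MonoidalCategory C] [RigidCategory C]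
  {R : C ⥤ Center C} {adj : Center.forget C ⊣ R}

namespace UnitarySubalgebra

/-- Restriction of class functions along `L ⟶ A`: `Res : Hom_C(A, 𝟙) ⟶ Hom_C(L, 𝟙)`. -/
def res (S : UnitarySubalgebra adj) (f : (adjointAlgebra adj).1 ⟶ 𝟙_ C) : S.L.1 ⟶ 𝟙_ C :=
  S.incl.f ≫ f

/-- The restriction of `ε_𝟙 : A ⟶ 𝟙` to `L`. -/
def counitRes (S : UnitarySubalgebra adj) : S.L.1 ⟶ 𝟙_ C := S.res (counit adj)

/-- The restriction of the action `α_M` to `L`. -/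
def actionRes (S : UnitarySubalgebra adj) (M : C) : S.L.1 ⊗ M ⟶ M :=
  S.incl.f ▷ M ≫ action adj M

/-- The full subcategory of the objects `M` on which `L` acts trivially: the restriction of
`α_M` to `L ⊗ M` is the restricted counit tensored with `id_M`. -/
def triv (S : UnitarySubalgebra adj) : ObjectProperty C := fun M =>
  S.actionRes M = S.counitRes ▷ M ≫ (λ_ M).hom

theorem actionRes_naturality (S : UnitarySubalgebra adj) {M N : C} (f : M ⟶ N) :
    S.actionRes M ≫ f = S.L.1 ◁ f ≫ S.actionRes N := by
  simp only [actionRes, Category.assoc, action_naturality]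
  rw [whisker_exchange_assoc]

theorem trivial_naturality (S : UnitarySubalgebra adj) {M N : C} (f : M ⟶ N) :
    (S.counitRes ▷ M ≫ (λ_ M).hom) ≫ f =
      S.L.1 ◁ f ≫ S.counitRes ▷ N ≫ (λ_ N).hom := by
  rw [whisker_exchange_assoc]
  simp

instance (S : UnitarySubalgebra adj) : S.triv.IsClosedUnderSubobjects where
  prop_of_mono {M N} f _ hN := by
    unfold triv at hN ⊢
    rw [← cancel_mono f, actionRes_naturality, trivial_naturality, hN]

instance (S : UnitarySubalgebra adj) : S.triv.IsClosedUnderQuotients where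
  prop_of_epi {M N} f _ hM := by
    have : (tensorLeft S.L.1).IsLeftAdjoint :=
      (tensorLeftAdjunction (ᘁS.L.1 : C) S.L.1).isLeftAdjoint
    have : Epi (S.L.1 ◁ f) := inferInstanceAs (Epi ((tensorLeft S.L.1).map f))
    unfold triv at hM ⊢
    rw [← cancel_epi (S.L.1 ◁ f), ← actionRes_naturality, ← trivial_naturality, hM]

instance (S : UnitarySubalgebra adj) (J : Type*) [Category* J] :
    S.triv.IsClosedUnderLimitsOfShape J where
  limitsOfShape_le := by
    rintro M ⟨p⟩
    refine p.isLimit.hom_ext fun j => ?_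
    have := p.prop_diag_obj j
    unfold triv at this
    exact (S.actionRes_naturality _).trans
      ((congrArg _ this).trans (S.trivial_naturality _).symm)

instance (S : UnitarySubalgebra adj) : S.triv.ContainsZero where
  exists_zero := ⟨0, isZero_zero C, by
    unfold triv
    exact (isZero_zero C).eq_of_tgt _ _⟩

/-- Together with the previous instances: `C_L^triv` is a full abelian subcategory of `C`. -/
instance (S : UnitarySubalgebra adj) : S.triv.IsClosedUnderFiniteProducts where

end UnitarySubalgebra

/-- `V` is a subquotient of `M`, i.e. a quotient of a subobject of `M`. -/
def IsSubquotient (V M : C) : Prop :=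
  ∃ (N : C) (i : N ⟶ M) (q : N ⟶ V), Mono i ∧ Epi q

namespace UnitarySubalgebra

variable (k : Type w) [Field k] [Linear k C] [MonoidalPreadditive C] [MonoidalLinear k C]
  [IsFiniteTensorCategory k C]

/-- `Res(ch(M)) = d(M) ε_L`: the character of `M` has trivial restriction to `L`. -/
def HasTrivialCharacter (S : UnitarySubalgebra adj) (p : PivotalStructure C) (M : C) : Prop :=
  S.res (character adj p M) = p.dim k M • S.counitRes

/-- The full abelian subcategory `S_L` of `C` generated by the simple objects whose character has
trivial restriction to `L`: the objects all of whose composition factors are such simple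
objects. (For semisimple `C` these are the direct sums of such simple objects.) -/
def charSubcategory (S : UnitarySubalgebra adj) (p : PivotalStructure C) : ObjectProperty C :=
  fun M => ∀ V : C, Simple V → IsSubquotient V M → S.HasTrivialCharacter k p V

/-- `S_L` is a Serre subcategory, in particular an abelian subcategory. -/
instance (S : UnitarySubalgebra adj) (p : PivotalStructure C) :
    (S.charSubcategory k p).IsSerreClass where
  exists_zero := ⟨0, isZero_zero C, by
    rintro V hV ⟨N, i, q, hi, hq⟩
    have hN : IsZero N := (isZero_zero C).of_mono i
    exact absurd (hN.of_epi q) (Simple.not_isZero V)⟩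
  prop_of_mono := by
    rintro X Y f hf hY V hV ⟨N, i, q, hi, hq⟩
    exact hY V hV ⟨N, i ≫ f, q, mono_comp _ _, hq⟩
  prop_of_epi := by
    rintro X Y f hf hX V hV ⟨N, i, q, hi, hq⟩
    exact hX V hV ⟨pullback f i, pullback.fst f i, pullback.snd f i ≫ q,
      inferInstance, epi_comp _ _⟩
  prop_X₂_of_shortExact := by
    rintro T hT h₁ h₃ V hV ⟨N, i, q, hi, hq⟩
    have := hT.mono_f
    have := hT.epi_g
    -- the part of `N` inside `T.X₁`
    let K := pullback T.f i
    let a : K ⟶ N := pullback.snd T.f i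
    by_cases h : a ≫ q = 0
    · -- `q` factors through the image of `N` in `T.X₃`
      have hker : kernel.ι (i ≫ T.g) ≫ q = 0 := by
        have e : (kernel.ι (i ≫ T.g) ≫ i) ≫ T.g = 0 := by
          rw [Category.assoc, kernel.condition]
        have e' := hT.exact.lift_f (kernel.ι (i ≫ T.g) ≫ i) e
        have : kernel.ι (i ≫ T.g) = pullback.lift _ _ e' ≫ a :=
          (pullback.lift_snd _ _ _).symm
        rw [this, Category.assoc, h, comp_zero]
      let r : Abelian.coimage (i ≫ T.g) ⟶ V := cokernel.desc _ q hker
      have hr : cokernel.π (kernel.ι (i ≫ T.g)) ≫ r = q := cokernel.π_desc _ _ _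
      have : Epi r := epi_of_epi_fac hr
      exact h₃ V hV ⟨_, Abelian.factorThruCoimage (i ≫ T.g), r, inferInstance, this⟩
    · have : Epi (a ≫ q) := epi_of_nonzero_to_simple h
      exact h₁ V hV ⟨K, pullback.fst T.f i, a ≫ q, inferInstance, this⟩

end UnitarySubalgebra

end Subcategories

end FTC
end

/-!
A natural transformation `a : B ⊗ - ⟶ Id` that equals `ε ⊗ -` at `M` does so at every subquotient
of `M`: pass to a subobject by cancelling a mono in the target, and to a quotient by cancelling an
epi in the source, where `B ⊗ -` preserves epis because it is a left adjoint. At an object where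
the restricted action is `ε ⊗ id`, the scalar `ε` comes out of the partial pivotal trace, which
leaves `ε` composed with the trace of the identity.
-/

namespace FTC

section EqLocus

variable {C D : Type*} [Category* C] [Category* D] {F G : C ⥤ D}

/-- The full subcategory of the objects at which two natural transformations agree. It expresses
triviality of an action as agreement with the scalar action. -/
def eqLocus (a b : F ⟶ G) : ObjectProperty C := fun X => a.app X = b.app X

instance (a b : F ⟶ G) [G.PreservesMonomorphisms] : (eqLocus a b).IsClosedUnderSubobjects where
  prop_of_mono f _ hY := by
    rw [eqLocus] at hY ⊢
    rw [← cancel_mono (G.map f), ← a.naturality, ← b.naturality, hY]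

instance (a b : F ⟶ G) [F.PreservesEpimorphisms] : (eqLocus a b).IsClosedUnderQuotients where
  prop_of_epi f _ hX := by
    rw [eqLocus] at hX ⊢
    rw [← cancel_epi (F.map f), a.naturality, b.naturality, hX]

end EqLocus

namespace IsSubquotient

variable {C : Type u} [Category.{v} C]

theorem refl (M : C) : IsSubquotient M M :=
  ⟨M, 𝟙 M, 𝟙 M, inferInstance, inferInstance⟩

theorem prop {V M : C} (h : IsSubquotient V M) (P : ObjectProperty C)
    [P.IsClosedUnderSubobjects] [P.IsClosedUnderQuotients] (hM : P M) : P V := by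
  obtain ⟨N, i, q, _, _⟩ := h
  exact P.prop_of_epi q (P.prop_of_mono i hM)

end IsSubquotient

namespace PivotalStructure

variable {C : Type u} [Category.{v} C] [MonoidalCategory C] [RightRigidCategory C]

theorem partialTrace_whiskerRight_comp (p : PivotalStructure C) {A A' B X : C} (g : A' ⟶ A)
    (f : A ⊗ X ⟶ B ⊗ X) : p.partialTrace X (g ▷ X ≫ f) = g ≫ p.partialTrace X f := by
  simp only [partialTrace, comp_whiskerRight, Category.assoc]
  rw [rightUnitor_inv_naturality_assoc, ← whisker_exchange_assoc,
    associator_inv_naturality_left_assoc]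

theorem partialTrace_whiskerRight (p : PivotalStructure C) {A : C} (X : C) (g : A ⟶ 𝟙_ C) :
    p.partialTrace X (g ▷ X) = g ≫ p.trace (𝟙 X) := by
  rw [trace, ← partialTrace_whiskerRight_comp, whiskerLeft_id, Category.comp_id]

end PivotalStructure

section Actions

instance {C : Type*} [Category* C] [MonoidalCategory C] [LeftRigidCategory C] (B : C) :
    (tensorLeft B).IsLeftAdjoint :=
  (tensorLeftAdjunction (ᘁB : C) B).isLeftAdjoint

/-- The action of `B` on all objects of `C` through a morphism `ε : B ⟶ 𝟙`. -/
def scalarAction {C : Type*} [Category* C] [MonoidalCategory C] {B : C} (ε : B ⟶ 𝟙_ C) :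
    tensorLeft B ⟶ 𝟭 C where
  app M := ε ▷ M ≫ (λ_ M).hom
  naturality M N f := by
    change B ◁ f ≫ ε ▷ N ≫ (λ_ N).hom = (ε ▷ M ≫ (λ_ M).hom) ≫ f
    rw [whisker_exchange_assoc, Category.assoc, leftUnitor_naturality]

variable {C : Type u} [Category.{v} C] [MonoidalCategory C] [RigidCategory C]
  {R : C ⥤ Center C} (adj : Center.forget C ⊣ R)

/-- The canonical action of the adjoint algebra on all objects of `C`, restricted along a
morphism `φ : B ⟶ A`. -/
def restrictedAction {B : C} (φ : B ⟶ (adjointAlgebra adj).1) : tensorLeft B ⟶ 𝟭 C where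
  app M := φ ▷ M ≫ action adj M
  naturality M N f := by
    change B ◁ f ≫ φ ▷ N ≫ action adj N = (φ ▷ M ≫ action adj M) ≫ f
    rw [Category.assoc, action_naturality, whisker_exchange_assoc]

theorem comp_character (p : PivotalStructure C) {B : C} (φ : B ⟶ (adjointAlgebra adj).1) (M : C) :
    φ ≫ character adj p M = p.partialTrace M (φ ▷ M ≫ action adj M ≫ (λ_ M).inv) :=
  (p.partialTrace_whiskerRight_comp φ _).symm

end Actions

theorem UnitarySubalgebra.hasTrivialCharacter_iff {k : Type w} [Field k] {C : Type u}
    [Category.{v} C] [Abelian C] [Linear k C] [MonoidalCategory C] [MonoidalPreadditive C]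
    [MonoidalLinear k C] [RigidCategory C] [IsFiniteTensorCategory k C] {R : C ⥤ Center C}
    {adj : Center.forget C ⊣ R} (S : UnitarySubalgebra adj) (p : PivotalStructure C) (M : C) :
    S.HasTrivialCharacter k p M ↔
      S.res (character adj p M) = S.counitRes ≫ p.trace (𝟙 M) := by
  rw [HasTrivialCharacter, ← p.dim_smul_id k, Linear.comp_smul, Category.comp_id]

end FTC

theorem proposition3p63_general {C : Type u} [Category.{v} C] [MonoidalCategory C]
    [RigidCategory C] (p : FTC.PivotalStructure C) {R : C ⥤ Center C}
    (adj : Center.forget C ⊣ R) {B : C} (φ : B ⟶ (FTC.adjointAlgebra adj).1) {M V : C}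
    (hM : φ ▷ M ≫ FTC.action adj M = (φ ≫ FTC.counit adj) ▷ M ≫ (λ_ M).hom)
    (hV : FTC.IsSubquotient V M) :
    φ ≫ FTC.character adj p V = (φ ≫ FTC.counit adj) ≫ p.trace (𝟙 V) := by
  have hV_triv : φ ▷ V ≫ FTC.action adj V = (φ ≫ FTC.counit adj) ▷ V ≫ (λ_ V).hom :=
    hV.prop (FTC.eqLocus (FTC.restrictedAction adj φ) (FTC.scalarAction (φ ≫ FTC.counit adj))) hM
  calc φ ≫ FTC.character adj p V
    _ = p.partialTrace V (φ ▷ V ≫ FTC.action adj V ≫ (λ_ V).inv) := FTC.comp_character ..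
    _ = p.partialTrace V ((φ ≫ FTC.counit adj) ▷ V) := by
      rw [reassoc_of% hV_triv, Iso.hom_inv_id, Category.comp_id]
    _ = (φ ≫ FTC.counit adj) ≫ p.trace (𝟙 V) := p.partialTrace_whiskerRight ..

theorem proposition3p63 {k : Type w} [Field k] [IsAlgClosed k] [CharZero k]
    {C : Type u} [Category.{v} C] [Abelian C] [Linear k C]
    [MonoidalCategory C] [MonoidalPreadditive C] [MonoidalLinear k C] [RigidCategory C]
    [FTC.IsFiniteTensorCategory k C] (p : FTC.PivotalStructure C)
    {R : C ⥤ Center C} (adj : Center.forget C ⊣ R) (S : FTC.UnitarySubalgebra adj) :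
    S.triv ≤ S.charSubcategory k p ∧
      ∀ M : C, S.triv M → S.HasTrivialCharacter k p M :=
  ⟨fun _ hM V _ hV => (S.hasTrivialCharacter_iff p V).2 (proposition3p63_general p adj _ hM hV),
    fun M hM => (S.hasTrivialCharacter_iff p M).2 (proposition3p63_general p adj _ hM (.refl M))⟩
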